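/- Let $\mathcal{Y}$ be a finite set, let $M, T$ be integers with $1 < T < M/2$, and let $\mu_1, \dots, \mu_M$ and $\pi$ be probability mass functions on $\mathcal{Y}$, all with full support, such that $\mu_i \neq \pi$ for every $i$. For each set $S \subset \{1, \dots, M\}$ with $|S| = T$ let $H_S$ be the hypothesis that all the entries $Y^{(i)}_k$, $1 \le i \le M$, $1 \le k \le n$, are independent, with $Y^{(i)}_k \sim \mu_i$ if $i \in S$ and $Y^{(i)}_k \sim \pi$ if $i \notin S$; thus the observations $y = (y^{(i)}_k) \in \mathcal{Y}^{Mn}$ have the joint probability mass function $$p_S(y) = \prod_{k=1}^n \Big\{ \prod_{i \in S} \mu_i(y^{(i)}_k) \prod_{j \notin S} \pi(y^{(j)}_k) \Big\}.$$ A test $\delta$ is a sequence of maps $\delta_n : \mathcal{Y}^{Mn} \to \{S \subset \{1, \dots, M\} : |S| = T\}$, $n \ge 1$, which may depend on the known $\mu_1, \dots, \mu_M, \pi$. Its maximal error probability is $e_n(\delta) = \max_{|S| = T} \sum_{y : \delta_n(y) \ne S} p_S(y)$, and its error exponent is $\lim_{n \to \infty} -\frac1n \log e_n(\delta)$. Put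 $$C(p, q) = \max_{s \in [0,1]} -\log \sum_{x} p(x)^s q(x)^{1-s}, \qquad B(p, q) = -\log \sum_x p(x)^{1/2} q(x)^{1/2}.$$ Then the optimal error exponent is $$E = \min_{1 \le i < j \le M} C\big( \mu_i(y) \pi(y'),\ \pi(y) \mu_j(y') \big),$$ where both arguments of $C$ are probability mass functions of $(y, y') \in \mathcal{Y} \times \mathcal{Y}$. That is, some test has error exponent $E$, and $\limsup_{n \to \infty} -\frac1n \log e_n(\delta) \le E$ for every test $\delta$. When all outliers are identically distributed, i.e. $\mu_i = \mu \neq \pi$ for $i = 1, \dots, M$, the optimal error exponent is equal to $2B(\mu, \pi)$ for all $M$ and $T$ with $1 < T < M/2$; in particular it is independent of $M$. -/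

import Mathlib

open Filter Topology

noncomputable section

namespace OutlierTesting

/-- The Bhattacharyya distance `B(p, q) = -log ∑ p(y)^{1/2} q(y)^{1/2}` on a finite alphabet. -/
def bhattacharyya {α : Type*} [Fintype α] (p q : α → ℝ) : ℝ :=
  -Real.log (∑ y, p y ^ (1 / 2 : ℝ) * q y ^ (1 / 2 : ℝ))

/-- The Chernoff information `C(p, q) = max_{s ∈ [0,1]} -log ∑ p(y)^s q(y)^{1-s}` on a finite
alphabet. For distributions of full support the supremum is attained, see `isGreatest_chernoff`. -/
def chernoff {α : Type*} [Fintype α] (p q : α → ℝ) : ℝ :=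
  sSup ((fun s : ℝ => -Real.log (∑ y, p y ^ s * q y ^ (1 - s))) '' Set.Icc 0 1)

/-- For positive functions on a nonempty finite alphabet the supremum in `chernoff` is a maximum. -/
theorem isGreatest_chernoff {α : Type*} [Fintype α] [Nonempty α] {p q : α → ℝ}
    (hp : ∀ y, 0 < p y) (hq : ∀ y, 0 < q y) :
    IsGreatest ((fun s : ℝ => -Real.log (∑ y, p y ^ s * q y ^ (1 - s))) '' Set.Icc 0 1)
      (chernoff p q) := by
  refine IsCompact.isGreatest_sSup (isCompact_Icc.image ?_) ⟨_, 0, by simp, rfl⟩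
  have hpos : ∀ s : ℝ, 0 < ∑ y, p y ^ s * q y ^ (1 - s) := fun s =>
    Finset.sum_pos (fun y _ => mul_pos (Real.rpow_pos_of_pos (hp y) _)
      (Real.rpow_pos_of_pos (hq y) _)) Finset.univ_nonempty
  refine (Continuous.log ?_ fun s => (hpos s).ne').neg
  refine continuous_finsetSum _ fun y _ => Continuous.mul ?_ ?_
  · exact Real.continuous_const_rpow (hp y).ne'
  · exact (Real.continuous_const_rpow (hq y).ne').comp (continuous_const.sub continuous_id)

/-- `n` observations of `M` coordinates: `y i k` is the `i`-th coordinate of the `k`-th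
observation. -/
abbrev Observations (𝒴 : Type*) (M n : ℕ) : Type _ := Fin M → Fin n → 𝒴

/-- The possible sets of outlier coordinates: all the `T`-element subsets of the `M` coordinates. -/
abbrev Hypothesis (M T : ℕ) : Type := {S : Finset (Fin M) // S.card = T}

/-- The joint distribution of all the observations when `S` is the set of outliers, the outlier
coordinate `i` follows `μ i`, and the typical coordinates follow `π`. -/
def jointPmf {𝒴 : Type*} {M n : ℕ} (μ : Fin M → 𝒴 → ℝ) (π : 𝒴 → ℝ) (S : Finset (Fin M))
    (y : Observations 𝒴 M n) : ℝ :=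
  ∏ k, ((∏ i ∈ S, μ i (y i k)) * ∏ j ∈ Sᶜ, π (y j k))

/-- A test for every sample size `n`. -/
abbrev Test (𝒴 : Type*) (M T : ℕ) : Type _ := (n : ℕ) → Observations 𝒴 M n → Hypothesis M T

/-- The maximal error probability of the test `δ` for sample size `n`. -/
def maxError {𝒴 : Type*} [Fintype 𝒴] {M T : ℕ} (μ : Fin M → 𝒴 → ℝ) (π : 𝒴 → ℝ)
    (δ : Test 𝒴 M T) (n : ℕ) : ℝ :=
  ⨆ S : Hypothesis M T, ∑ y : Observations 𝒴 M n with δ n y ≠ S, jointPmf μ π S.1 y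

/-- The normalized exponent `-(1/n) log e_n` of the maximal error probability. -/
def errorRate {𝒴 : Type*} [Fintype 𝒴] {M T : ℕ} (μ : Fin M → 𝒴 → ℝ) (π : 𝒴 → ℝ)
    (δ : Test 𝒴 M T) (n : ℕ) : ℝ :=
  -(1 / (n : ℝ)) * Real.log (maxError μ π δ n)

/-- The test `δ` has error exponent `a`: `-(1/n) log e_n` converges to `a`. -/
def HasErrorExponent {𝒴 : Type*} [Fintype 𝒴] {M T : ℕ} (μ : Fin M → 𝒴 → ℝ) (π : 𝒴 → ℝ)
    (δ : Test 𝒴 M T) (a : ℝ) : Prop :=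
  Tendsto (errorRate μ π δ) atTop (𝓝 a)

/-- `a` is the optimal error exponent for testing among all sets of `T` outliers when `μ` and `π`
are known (tests may depend on them): some test has the exponent `a`, and no test does better, not
even along a subsequence of sample sizes. -/
def IsOptimalErrorExponent {𝒴 : Type*} [Fintype 𝒴] {M : ℕ} (T : ℕ) (μ : Fin M → 𝒴 → ℝ)
    (π : 𝒴 → ℝ) (a : ℝ) : Prop :=
  (∃ δ : Test 𝒴 M T, HasErrorExponent μ π δ a) ∧
    ∀ δ : Test 𝒴 M T, limsup (fun n => (errorRate μ π δ n : EReal)) atTop ≤ (a : EReal)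

/-- The optimal error exponent is the largest error exponent of a test, hence unique. -/
theorem IsOptimalErrorExponent.isGreatest {𝒴 : Type*} [Fintype 𝒴] {M T : ℕ}
    {μ : Fin M → 𝒴 → ℝ} {π : 𝒴 → ℝ} {a : ℝ} (h : IsOptimalErrorExponent T μ π a) :
    IsGreatest {b | ∃ δ : Test 𝒴 M T, HasErrorExponent μ π δ b} a := by
  refine ⟨h.1, ?_⟩
  rintro b ⟨δ, hδ⟩
  have hb : Tendsto (fun n => (errorRate μ π δ n : EReal)) atTop (𝓝 (b : EReal)) :=
    (continuous_coe_real_ereal.tendsto b).comp hδ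
  have := h.2 δ
  rw [hb.limsup_eq] at this
  exact_mod_cast this

end OutlierTesting

end

/-! Everything is expressed through the affinity `∑ p^s q^(1-s)`, whose minimum over `s ∈ [0, 1]` is
`exp (-C(p, q))`. It factorizes over independent coordinates and samples, is at most `1`, and equals
`1` when both laws agree. So for two hypotheses only the coordinates on which they disagree matter,
and the hardest pairs differ by exchanging one outlier `i` for another `j`. Their affinity is
exactly that of the two-coordinate problem defining `E`; any other pair is at least as easy to tell
apart.

Achievability: the maximum likelihood test errs towards a given wrong set with probability at most
the `n`-th power of the affinity, and there are finitely many sets, so a union bound costs only a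
constant factor.

Converse: twice the maximal error of any test is at least `∑ min (p_S, p_S')`. Tilting at the
optimal `s` centers the log-likelihood ratio. Its sum over `n` samples is then of order `√n`, so
this overlap is `exp (-n C)` up to a factor `exp (-O(√n))` from below.

For identical outliers the two-coordinate affinity is symmetric under `s ↦ 1 - s`, and
Cauchy–Schwarz puts its minimum at `s = 1/2`. -/

namespace OutlierTesting

/-- The Chernoff `s`-affinity `∑ p(y)^s q(y)^{1-s}` of two functions on a finite alphabet. -/
noncomputable def affinity {α : Type*} [Fintype α] (p q : α → ℝ) (s : ℝ) : ℝ :=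
  ∑ y, p y ^ s * q y ^ (1 - s)

/-! ### Affinities and Chernoff information -/

section Affinity

variable {α : Type*} [Fintype α] {p q : α → ℝ}

theorem affinity_pos [Nonempty α] (hp : ∀ y, 0 < p y) (hq : ∀ y, 0 < q y) (s : ℝ) :
    0 < affinity p q s :=
  Finset.sum_pos (fun y _ => mul_pos (Real.rpow_pos_of_pos (hp y) _)
    (Real.rpow_pos_of_pos (hq y) _)) Finset.univ_nonempty

theorem affinity_nonneg (hp : ∀ y, 0 < p y) (hq : ∀ y, 0 < q y) (s : ℝ) :
    0 ≤ affinity p q s :=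
  Finset.sum_nonneg fun y _ => (mul_pos (Real.rpow_pos_of_pos (hp y) _)
    (Real.rpow_pos_of_pos (hq y) _)).le

theorem affinity_le_one (hp : ∀ y, 0 < p y) (hq : ∀ y, 0 < q y) (hp1 : ∑ y, p y = 1)
    (hq1 : ∑ y, q y = 1) {s : ℝ} (hs : s ∈ Set.Icc (0 : ℝ) 1) : affinity p q s ≤ 1 := by
  calc affinity p q s ≤ ∑ y, (s * p y + (1 - s) * q y) :=
        Finset.sum_le_sum fun y _ => Real.geom_mean_le_arith_mean2_weighted hs.1
          (sub_nonneg.2 hs.2) (hp y).le (hq y).le (by ring)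
    _ = 1 := by
        rw [Finset.sum_add_distrib, ← Finset.mul_sum, ← Finset.mul_sum, hp1, hq1]; ring

theorem affinity_swap (p q : α → ℝ) (s : ℝ) : affinity p q s = affinity q p (1 - s) := by
  simp only [affinity, sub_sub_cancel, mul_comm]

theorem affinity_self (hp : ∀ y, 0 < p y) (hp1 : ∑ y, p y = 1) (s : ℝ) :
    affinity p p s = 1 := by
  rw [← hp1]
  refine Finset.sum_congr rfl fun y _ => ?_
  rw [← Real.rpow_add (hp y), add_sub_cancel, Real.rpow_one]

theorem affinity_zero (hq1 : ∑ y, q y = 1) : affinity p q 0 = 1 := by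
  simp [affinity, hq1]

theorem affinity_one (hp1 : ∑ y, p y = 1) : affinity p q 1 = 1 := by
  simp [affinity, hp1]

theorem affinity_mul {β : Type*} [Fintype β] {p' q' : β → ℝ} (hp : ∀ y, 0 < p y)
    (hq : ∀ y, 0 < q y) (hp' : ∀ y, 0 < p' y) (hq' : ∀ y, 0 < q' y) (s : ℝ) :
    affinity (fun z : α × β => p z.1 * p' z.2) (fun z : α × β => q z.1 * q' z.2) s =
      affinity p q s * affinity p' q' s := by
  simp only [affinity, Fintype.sum_prod_type, Finset.sum_mul_sum]
  refine Finset.sum_congr rfl fun y _ => Finset.sum_congr rfl fun y' _ => ?_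
  rw [Real.mul_rpow (hp y).le (hp' y').le, Real.mul_rpow (hq y).le (hq' y').le]
  ring

theorem affinity_pi {ι : Type*} [Fintype ι] [DecidableEq ι] {v w : ι → α → ℝ}
    (hv : ∀ i y, 0 < v i y) (hw : ∀ i y, 0 < w i y) (s : ℝ) :
    affinity (fun z : ι → α => ∏ i, v i (z i)) (fun z : ι → α => ∏ i, w i (z i)) s =
      ∏ i, affinity (v i) (w i) s := by
  simp only [affinity]
  rw [Finset.prod_univ_sum, Fintype.piFinset_univ]
  refine Finset.sum_congr rfl fun z _ => ?_
  rw [← Real.finsetProd_rpow _ _ fun i _ => (hv i _).le,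
    ← Real.finsetProd_rpow _ _ fun i _ => (hw i _).le, Finset.prod_mul_distrib]

/-- Together with `exp_neg_chernoff_le`, this replaces the supremum of `-log` by a minimum of
affinities, the form used from here on. -/
theorem exists_chernoff_eq [Nonempty α] (hp : ∀ y, 0 < p y) (hq : ∀ y, 0 < q y) :
    ∃ s ∈ Set.Icc (0 : ℝ) 1, Real.exp (-chernoff p q) = affinity p q s := by
  obtain ⟨s, hs, h⟩ := (isGreatest_chernoff hp hq).1
  refine ⟨s, hs, ?_⟩
  rw [← h, neg_neg]
  exact Real.exp_log (affinity_pos hp hq s)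

theorem exp_neg_chernoff_le [Nonempty α] (hp : ∀ y, 0 < p y) (hq : ∀ y, 0 < q y) {s : ℝ}
    (hs : s ∈ Set.Icc (0 : ℝ) 1) : Real.exp (-chernoff p q) ≤ affinity p q s := by
  have h := (isGreatest_chernoff hp hq).2 ⟨s, hs, rfl⟩
  rw [← Real.le_log_iff_exp_le (affinity_pos hp hq s)]
  exact neg_le.1 h

/-- The minimum of the affinity over `[0, 1]` is attained in the interior. -/
theorem exists_interior_chernoff_eq [Nonempty α] (hp : ∀ y, 0 < p y) (hq : ∀ y, 0 < q y)
    (hp1 : ∑ y, p y = 1) (hq1 : ∑ y, q y = 1) :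
    ∃ s ∈ Set.Ioo (0 : ℝ) 1, Real.exp (-chernoff p q) = affinity p q s := by
  obtain ⟨s, hs, h⟩ := exists_chernoff_eq hp hq
  -- Both endpoints give affinity `1`, so a minimum below `1` is interior. A minimum equal to `1`
  -- forces the constant value `1` on `[0, 1]`, and then `1 / 2` serves.
  by_cases h1 : affinity p q s = 1
  · have hh : (1 / 2 : ℝ) ∈ Set.Icc (0 : ℝ) 1 := by constructor <;> norm_num
    refine ⟨1 / 2, by constructor <;> norm_num, le_antisymm (exp_neg_chernoff_le hp hq hh) ?_⟩
    rw [h, h1]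
    exact affinity_le_one hp hq hp1 hq1 hh
  · refine ⟨s, ⟨hs.1.lt_of_ne ?_, hs.2.lt_of_ne ?_⟩, h⟩
    · rintro rfl
      exact h1 (affinity_zero hq1)
    · rintro rfl
      exact h1 (affinity_one hp1)

theorem hasDerivAt_affinity (hp : ∀ y, 0 < p y) (hq : ∀ y, 0 < q y) (s : ℝ) :
    HasDerivAt (affinity p q)
      (∑ y, p y ^ s * q y ^ (1 - s) * (Real.log (p y) - Real.log (q y))) s := by
  refine HasDerivAt.fun_sum fun y _ => ?_
  have h1 : HasDerivAt (fun t : ℝ => p y ^ t) (Real.log (p y) * 1 * p y ^ s) s :=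
    (hasDerivAt_id s).const_rpow (hp y)
  have h2 : HasDerivAt (fun t : ℝ => q y ^ (1 - t)) (Real.log (q y) * (-1) * q y ^ (1 - s)) s :=
    ((hasDerivAt_id s).const_sub 1).const_rpow (hq y)
  exact (h1.mul h2).congr_deriv (by ring)

/-- At an interior minimizer of the affinity, the log-likelihood ratio has mean zero under the
tilted distribution. -/
theorem sum_tilted_logLikelihoodRatio_eq_zero [Nonempty α] (hp : ∀ y, 0 < p y)
    (hq : ∀ y, 0 < q y) {s : ℝ} (hs : s ∈ Set.Ioo (0 : ℝ) 1)
    (h : Real.exp (-chernoff p q) = affinity p q s) :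
    ∑ y, p y ^ s * q y ^ (1 - s) * (Real.log (p y) - Real.log (q y)) = 0 := by
  refine IsLocalMin.hasDerivAt_eq_zero ?_ (hasDerivAt_affinity hp hq s)
  filter_upwards [Ioo_mem_nhds hs.1 hs.2] with t ht
  rw [← h]
  exact exp_neg_chernoff_le hp hq (Set.Ioo_subset_Icc_self ht)

end Affinity

/-! ### Second moments, tilting and the converse half of Chernoff's theorem -/

section ProductMoments

variable {α : Type*} [Fintype α]

theorem sum_pi_prod_succ (n : ℕ) (F : (Fin (n + 1) → α) → ℝ) :
    ∑ y, F y = ∑ z : α, ∑ y : Fin n → α, F (Fin.cons z y) := by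
  rw [← (Fin.consEquiv fun _ : Fin (n + 1) => α).sum_comp, Fintype.sum_prod_type]
  rfl

/-- The moments of order at most two of a sum of `n` independent centered variables. -/
theorem sum_prod_moments {r L : α → ℝ} (h1 : ∑ z, r z = 1) (h0 : ∑ z, r z * L z = 0) (n : ℕ) :
    (∑ y : Fin n → α, ∏ k, r (y k) = 1) ∧
    (∑ y : Fin n → α, (∏ k, r (y k)) * ∑ k, L (y k) = 0) ∧
    ∑ y : Fin n → α, (∏ k, r (y k)) * (∑ k, L (y k)) ^ 2 = n * ∑ z, r z * L z ^ 2 := by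
  induction n with
  | zero => simp
  | succ n ih =>
    obtain ⟨i1, i2, i3⟩ := ih
    simp only [sum_pi_prod_succ, Fin.prod_univ_succ, Fin.sum_univ_succ, Fin.cons_zero,
      Fin.cons_succ]
    refine ⟨?_, ?_, ?_⟩
    · simp only [← Finset.mul_sum, i1, mul_one, h1]
    · calc _ = ∑ z, (r z * L z * ∑ y : Fin n → α, ∏ k, r (y k) +
              r z * ∑ y : Fin n → α, (∏ k, r (y k)) * ∑ k, L (y k)) := by
            refine Finset.sum_congr rfl fun z _ => ?_
            rw [Finset.mul_sum, Finset.mul_sum, ← Finset.sum_add_distrib]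
            exact Finset.sum_congr rfl fun y _ => by ring
        _ = 0 := by simp [i1, i2, h0]
    · calc _ = ∑ z, (r z * L z ^ 2 * ∑ y : Fin n → α, ∏ k, r (y k) +
              2 * (r z * L z) * (∑ y : Fin n → α, (∏ k, r (y k)) * ∑ k, L (y k)) +
              r z * ∑ y : Fin n → α, (∏ k, r (y k)) * (∑ k, L (y k)) ^ 2) := by
            refine Finset.sum_congr rfl fun z _ => ?_
            rw [Finset.mul_sum, Finset.mul_sum, Finset.mul_sum, ← Finset.sum_add_distrib,
              ← Finset.sum_add_distrib]
            exact Finset.sum_congr rfl fun y _ => by ring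
        _ = _ := by
            simp only [i1, i2, i3, Finset.sum_add_distrib, ← Finset.sum_mul, h1, mul_one, mul_zero,
              Finset.sum_const_zero]
            push_cast
            ring

/-- A lower bound for `𝔼 exp (-|Z|)`, `Z` a sum of `n` independent centered variables. -/
theorem exp_neg_le_sum_prod_exp_neg_abs {r L : α → ℝ} (hr : ∀ z, 0 ≤ r z) (h1 : ∑ z, r z = 1)
    (h0 : ∑ z, r z * L z = 0) (n : ℕ) {a : ℝ} (ha : 0 < a)
    (hna : n * ∑ z, r z * L z ^ 2 ≤ a ^ 2) :
    Real.exp (-a) ≤ ∑ y : Fin n → α, (∏ k, r (y k)) * Real.exp (-|∑ k, L (y k)|) := by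
  obtain ⟨i1, -, i3⟩ := sum_prod_moments h1 h0 n
  -- A minorant quadratic in `x`, so that second moments suffice: `exp t ≥ 1 + t` at `t = a - |x|`,
  -- then `|x| ≤ x² / (2a) + a / 2`.
  have key : ∀ x : ℝ, Real.exp (-a) * (1 + a / 2 - x ^ 2 / (2 * a)) ≤ Real.exp (-|x|) := by
    intro x
    have e1 : Real.exp (-|x|) = Real.exp (-a) * Real.exp (a - |x|) := by
      rw [← Real.exp_add]; ring_nf
    rw [e1]
    refine mul_le_mul_of_nonneg_left ?_ (Real.exp_pos _).le
    have e2 := Real.add_one_le_exp (a - |x|)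
    have e3 : |x| ≤ x ^ 2 / (2 * a) + a / 2 := by
      rw [← sq_abs x, div_add_div _ _ (by positivity) two_ne_zero, le_div_iff₀ (by positivity)]
      nlinarith [sq_nonneg (|x| - a)]
    linarith
  calc Real.exp (-a)
      ≤ Real.exp (-a) * (1 + a / 2 - (n * ∑ z, r z * L z ^ 2) / (2 * a)) := by
        refine le_mul_of_one_le_right (Real.exp_pos _).le ?_
        have : (n * ∑ z, r z * L z ^ 2) / (2 * a) ≤ a / 2 := by
          rw [div_le_div_iff₀ (by positivity) two_pos]
          nlinarith
        linarith
    _ = ∑ y : Fin n → α, (∏ k, r (y k)) *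
          (Real.exp (-a) * (1 + a / 2 - (∑ k, L (y k)) ^ 2 / (2 * a))) := by
        have h : ∀ y : Fin n → α, (∏ k, r (y k)) *
            (Real.exp (-a) * (1 + a / 2 - (∑ k, L (y k)) ^ 2 / (2 * a))) =
            Real.exp (-a) * (1 + a / 2) * (∏ k, r (y k)) -
              Real.exp (-a) / (2 * a) * ((∏ k, r (y k)) * (∑ k, L (y k)) ^ 2) :=
          fun y => by ring
        simp only [h, Finset.sum_sub_distrib, ← Finset.mul_sum, i1, i3]
        ring
    _ ≤ _ := Finset.sum_le_sum fun y _ =>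
        mul_le_mul_of_nonneg_left (key _) (Finset.prod_nonneg fun k _ => hr _)

/-- On the logarithmic scale, a weighted mean of two numbers exceeds neither of them by more than
their distance. -/
theorem tilted_mul_exp_neg_abs_le_min {a b s : ℝ} (ha : 0 < a) (hb : 0 < b)
    (hs : s ∈ Set.Icc (0 : ℝ) 1) :
    a ^ s * b ^ (1 - s) * Real.exp (-|Real.log a - Real.log b|) ≤ min a b := by
  obtain ⟨h0, h1⟩ := hs
  have h : a ^ s * b ^ (1 - s) * Real.exp (-|Real.log a - Real.log b|) =
      Real.exp (Real.log a * s + Real.log b * (1 - s) - |Real.log a - Real.log b|) := by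
    rw [Real.rpow_def_of_pos ha, Real.rpow_def_of_pos hb, ← Real.exp_add, ← Real.exp_add,
      ← sub_eq_add_neg]
  rw [h, le_min_iff, ← Real.le_log_iff_exp_le ha, ← Real.le_log_iff_exp_le hb]
  constructor
  · nlinarith [neg_abs_le (Real.log a - Real.log b), abs_nonneg (Real.log a - Real.log b)]
  · nlinarith [le_abs_self (Real.log a - Real.log b), abs_nonneg (Real.log a - Real.log b)]

/-- The converse half of Chernoff's theorem, non-asymptotically. -/
theorem exists_le_sum_min_prod [Nonempty α] {p q : α → ℝ} (hp : ∀ y, 0 < p y)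
    (hq : ∀ y, 0 < q y) (hp1 : ∑ y, p y = 1) (hq1 : ∑ y, q y = 1) :
    ∃ K : ℝ, 0 < K ∧ ∀ n : ℕ, 0 < n →
      Real.exp (-(n * chernoff p q) - √(n * K)) ≤
        ∑ y : Fin n → α, min (∏ k, p (y k)) (∏ k, q (y k)) := by
  obtain ⟨s, hs, hC⟩ := exists_interior_chernoff_eq hp hq hp1 hq1
  have hd := sum_tilted_logLikelihoodRatio_eq_zero hp hq hs hC
  set g := affinity p q s
  have gpos : 0 < g := affinity_pos hp hq s
  set t : α → ℝ := fun y => p y ^ s * q y ^ (1 - s)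
  have tpos : ∀ y, 0 < t y := fun y =>
    mul_pos (Real.rpow_pos_of_pos (hp y) _) (Real.rpow_pos_of_pos (hq y) _)
  set L : α → ℝ := fun y => Real.log (p y) - Real.log (q y)
  -- The tilted distribution, under which `L` has mean zero by the choice of `s`.
  set r : α → ℝ := fun y => t y / g with hr
  have rnn : ∀ y, 0 ≤ r y := fun y => (div_pos (tpos y) gpos).le
  have r1 : ∑ y, r y = 1 := by
    rw [hr, ← Finset.sum_div]
    exact div_self gpos.ne'
  have r0 : ∑ y, r y * L y = 0 := by
    have : ∀ y, r y * L y = t y * L y / g := fun y => by simp only [hr]; ring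
    simp only [this, ← Finset.sum_div]
    rw [hd, zero_div]
  have hV : 0 ≤ ∑ z, r z * L z ^ 2 :=
    Finset.sum_nonneg fun z _ => mul_nonneg (rnn z) (sq_nonneg _)
  -- The `+ 1` keeps `a = √(n * K)` positive even when the variance of `L` vanishes, as it does for
  -- `p = q`.
  refine ⟨∑ z, r z * L z ^ 2 + 1, by positivity, fun n hn => ?_⟩
  have hn' : (0 : ℝ) < n := Nat.cast_pos.2 hn
  have hb := exp_neg_le_sum_prod_exp_neg_abs rnn r1 r0 n
    (a := √(n * (∑ z, r z * L z ^ 2 + 1))) (Real.sqrt_pos.2 (by positivity))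
    (by rw [Real.sq_sqrt (by positivity)]; nlinarith)
  have e1 : Real.exp (-(n * chernoff p q) - √(n * (∑ z, r z * L z ^ 2 + 1))) =
      g ^ n * Real.exp (-√(n * (∑ z, r z * L z ^ 2 + 1))) := by
    rw [sub_eq_add_neg, Real.exp_add, ← hC, ← Real.exp_nat_mul, mul_neg]
  rw [e1]
  refine (mul_le_mul_of_nonneg_left hb (pow_nonneg gpos.le n)).trans ?_
  rw [Finset.mul_sum]
  refine Finset.sum_le_sum fun y _ => ?_
  refine le_trans (le_of_eq ?_) (tilted_mul_exp_neg_abs_le_min (s := s)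
    (Finset.prod_pos fun k _ => hp (y k)) (Finset.prod_pos fun k _ => hq (y k))
    (Set.Ioo_subset_Icc_self hs))
  rw [← Real.finsetProd_rpow _ _ fun i _ => (hp _).le,
    ← Real.finsetProd_rpow _ _ fun i _ => (hq _).le, Real.log_prod fun i _ => (hp _).ne',
    Real.log_prod fun i _ => (hq _).ne', ← Finset.sum_sub_distrib, ← Finset.prod_mul_distrib,
    ← mul_assoc]
  congr 1
  simp only [hr, Finset.prod_div_distrib, Finset.prod_const, Finset.card_univ, Fintype.card_fin]
  rw [mul_div_cancel₀ _ (pow_pos gpos n).ne']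

end ProductMoments

/-! ### Laws of the observations under each hypothesis -/

section Testing

variable {𝒴 : Type*} {M : ℕ} {μ : Fin M → 𝒴 → ℝ} {π : 𝒴 → ℝ}

/-- The distribution of one coordinate when `S` is the set of outliers. -/
def marginal (μ : Fin M → 𝒴 → ℝ) (π : 𝒴 → ℝ) (S : Finset (Fin M)) (i : Fin M) : 𝒴 → ℝ :=
  if i ∈ S then μ i else π

/-- The distribution of one observation when `S` is the set of outliers. -/
def singlePmf (μ : Fin M → 𝒴 → ℝ) (π : 𝒴 → ℝ) (S : Finset (Fin M)) (z : Fin M → 𝒴) : ℝ :=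
  ∏ i, marginal μ π S i (z i)

theorem marginal_pos (hμ : ∀ i y, 0 < μ i y) (hπ : ∀ y, 0 < π y) (S : Finset (Fin M))
    (i : Fin M) (y : 𝒴) : 0 < marginal μ π S i y := by
  unfold marginal
  split_ifs
  exacts [hμ i y, hπ y]

theorem singlePmf_pos (hμ : ∀ i y, 0 < μ i y) (hπ : ∀ y, 0 < π y) (S : Finset (Fin M))
    (z : Fin M → 𝒴) : 0 < singlePmf μ π S z :=
  Finset.prod_pos fun i _ => marginal_pos hμ hπ S i _

theorem jointPmf_eq_prod_singlePmf {n : ℕ} (S : Finset (Fin M)) (y : Observations 𝒴 M n) :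
    jointPmf μ π S y = ∏ k, singlePmf μ π S fun i => y i k := by
  refine Finset.prod_congr rfl fun k _ => ?_
  rw [singlePmf, ← Finset.prod_mul_prod_compl S]
  congr 1 <;> refine Finset.prod_congr rfl fun i hi => ?_
  · rw [marginal, if_pos hi]
  · rw [marginal, if_neg (Finset.mem_compl.1 hi)]

theorem jointPmf_pos (hμ : ∀ i y, 0 < μ i y) (hπ : ∀ y, 0 < π y) {n : ℕ} (S : Finset (Fin M))
    (y : Observations 𝒴 M n) : 0 < jointPmf μ π S y := by
  rw [jointPmf_eq_prod_singlePmf]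
  exact Finset.prod_pos fun k _ => singlePmf_pos hμ hπ S _

variable [Fintype 𝒴]

theorem sum_singlePmf (hμ1 : ∀ i, ∑ y, μ i y = 1) (hπ1 : ∑ y, π y = 1) (S : Finset (Fin M)) :
    ∑ z, singlePmf μ π S z = 1 := by
  have h : ∏ i, ∑ y, marginal μ π S i y = 1 := Finset.prod_eq_one fun i _ => by
    unfold marginal
    split_ifs
    exacts [hμ1 i, hπ1]
  rw [← h, Finset.prod_univ_sum, Fintype.piFinset_univ]
  rfl

theorem affinity_singlePmf (hμ : ∀ i y, 0 < μ i y) (hπ : ∀ y, 0 < π y) (S S' : Finset (Fin M))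
    (s : ℝ) : affinity (singlePmf μ π S) (singlePmf μ π S') s =
      ∏ i, affinity (marginal μ π S i) (marginal μ π S' i) s :=
  affinity_pi (marginal_pos hμ hπ S) (marginal_pos hμ hπ S') s

theorem affinity_marginal_le_one (hμ : ∀ i y, 0 < μ i y) (hπ : ∀ y, 0 < π y)
    (hμ1 : ∀ i, ∑ y, μ i y = 1) (hπ1 : ∑ y, π y = 1) (S S' : Finset (Fin M)) (i : Fin M) {s : ℝ}
    (hs : s ∈ Set.Icc (0 : ℝ) 1) :
    affinity (marginal μ π S i) (marginal μ π S' i) s ≤ 1 := by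
  have h1 : ∀ S, ∑ y, marginal μ π S i y = 1 := fun S => by
    unfold marginal
    split_ifs
    exacts [hμ1 i, hπ1]
  exact affinity_le_one (marginal_pos hμ hπ S i) (marginal_pos hμ hπ S' i) (h1 S) (h1 S') hs

/-- Each coordinate other than `i` and `j` contributes a factor at most `1`, which is dropped. -/
theorem affinity_singlePmf_le (hμ : ∀ i y, 0 < μ i y) (hπ : ∀ y, 0 < π y)
    (hμ1 : ∀ i, ∑ y, μ i y = 1) (hπ1 : ∑ y, π y = 1) {S S' : Finset (Fin M)} {i j : Fin M}
    (hi : i ∈ S) (hi' : i ∉ S') (hj : j ∉ S) (hj' : j ∈ S') {s : ℝ}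
    (hs : s ∈ Set.Icc (0 : ℝ) 1) :
    affinity (singlePmf μ π S) (singlePmf μ π S') s ≤
      affinity (μ i) π s * affinity π (μ j) s := by
  have hij : i ≠ j := by
    rintro rfl
    exact hj hi
  have e : affinity (μ i) π s * affinity π (μ j) s =
      ∏ l ∈ {i, j}, affinity (marginal μ π S l) (marginal μ π S' l) s := by
    rw [Finset.prod_pair hij]
    simp [marginal, hi, hi', hj, hj']
  rw [affinity_singlePmf hμ hπ, e]
  have h0 : ∀ l, 0 ≤ affinity (marginal μ π S l) (marginal μ π S' l) s := fun l =>
    affinity_nonneg (marginal_pos hμ hπ S l) (marginal_pos hμ hπ S' l) s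
  rw [← Finset.prod_mul_prod_compl {i, j}]
  exact mul_le_of_le_one_right (Finset.prod_nonneg fun l _ => h0 l)
    (Finset.prod_le_one (fun l _ => h0 l)
      fun l _ => affinity_marginal_le_one hμ hπ hμ1 hπ1 S S' l hs)

/-- For neighbouring hypotheses all the other coordinates compare a law with itself and contribute
exactly `1`, so `affinity_singlePmf_le` is sharp here. -/
theorem affinity_singlePmf_insert (hμ : ∀ i y, 0 < μ i y) (hπ : ∀ y, 0 < π y)
    (hμ1 : ∀ i, ∑ y, μ i y = 1) (hπ1 : ∑ y, π y = 1) {R : Finset (Fin M)} {i j : Fin M}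
    (hij : i ≠ j) (hi : i ∉ R) (hj : j ∉ R) (s : ℝ) :
    affinity (singlePmf μ π (insert i R)) (singlePmf μ π (insert j R)) s =
      affinity (μ i) π s * affinity π (μ j) s := by
  have e : affinity (μ i) π s * affinity π (μ j) s = ∏ l ∈ {i, j},
      affinity (marginal μ π (insert i R) l) (marginal μ π (insert j R) l) s := by
    rw [Finset.prod_pair hij]
    simp [marginal, hi, hj, hij, hij.symm]
  rw [affinity_singlePmf hμ hπ, e]
  refine (Finset.prod_subset (Finset.subset_univ _) fun l _ hl => ?_).symm
  simp only [Finset.mem_insert, Finset.mem_singleton, not_or] at hl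
  simp only [marginal, Finset.mem_insert, hl.1, hl.2, false_or]
  split_ifs
  · exact affinity_self (hμ l) (hμ1 l) s
  · exact affinity_self hπ hπ1 s

theorem chernoff_singlePmf_insert (hμ : ∀ i y, 0 < μ i y) (hπ : ∀ y, 0 < π y)
    (hμ1 : ∀ i, ∑ y, μ i y = 1) (hπ1 : ∑ y, π y = 1) {R : Finset (Fin M)} {i j : Fin M}
    (hij : i ≠ j) (hi : i ∉ R) (hj : j ∉ R) :
    chernoff (singlePmf μ π (insert i R)) (singlePmf μ π (insert j R)) =
      chernoff (fun z : 𝒴 × 𝒴 => μ i z.1 * π z.2) (fun z : 𝒴 × 𝒴 => π z.1 * μ j z.2) := by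
  have h : affinity (singlePmf μ π (insert i R)) (singlePmf μ π (insert j R)) =
      affinity (fun z : 𝒴 × 𝒴 => μ i z.1 * π z.2) (fun z : 𝒴 × 𝒴 => π z.1 * μ j z.2) := by
    funext s
    rw [affinity_singlePmf_insert hμ hπ hμ1 hπ1 hij hi hj,
      affinity_mul (hμ i) hπ hπ (hμ j)]
  exact congrArg (fun f : ℝ → ℝ => sSup ((fun s => -Real.log (f s)) '' Set.Icc 0 1)) h

theorem sum_observations (n : ℕ) (F : (Fin n → Fin M → 𝒴) → ℝ) :
    ∑ y : Observations 𝒴 M n, F (fun k i => y i k) = ∑ y, F y :=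
  (Equiv.piComm fun (_ : Fin M) (_ : Fin n) => 𝒴).sum_comp F

theorem sum_jointPmf_rpow (hμ : ∀ i y, 0 < μ i y) (hπ : ∀ y, 0 < π y) (S S' : Finset (Fin M))
    (n : ℕ) (s : ℝ) :
    ∑ y : Observations 𝒴 M n, jointPmf μ π S y ^ s * jointPmf μ π S' y ^ (1 - s) =
      affinity (singlePmf μ π S) (singlePmf μ π S') s ^ n := by
  have h := affinity_pi (ι := Fin n) (fun _ => singlePmf_pos hμ hπ S)
    (fun _ => singlePmf_pos hμ hπ S') s
  simp only [Finset.prod_const, Finset.card_univ, Fintype.card_fin] at h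
  rw [← h, affinity, ← sum_observations]
  simp only [jointPmf_eq_prod_singlePmf]

/-! ### Error bounds and the optimal exponent -/

variable {T : ℕ}

theorem le_maxError (δ : Test 𝒴 M T) (n : ℕ) (S : Hypothesis M T) :
    ∑ y : Observations 𝒴 M n with δ n y ≠ S, jointPmf μ π S.1 y ≤ maxError μ π δ n :=
  le_ciSup (f := fun S : Hypothesis M T =>
    ∑ y : Observations 𝒴 M n with δ n y ≠ S, jointPmf μ π S.1 y) (Set.finite_range _).bddAbove S

/-- Every test errs at least as much as the best test between two of the hypotheses. -/
theorem sum_min_le_two_mul_maxError (hμ : ∀ i y, 0 < μ i y) (hπ : ∀ y, 0 < π y)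
    (δ : Test 𝒴 M T) (n : ℕ) {S S' : Hypothesis M T} (hS : S ≠ S') :
    ∑ y : Observations 𝒴 M n, min (jointPmf μ π S.1 y) (jointPmf μ π S'.1 y) ≤
      2 * maxError μ π δ n := by
  have h1 := le_maxError (μ := μ) (π := π) δ n S
  have h2 := le_maxError (μ := μ) (π := π) δ n S'
  rw [two_mul]
  refine le_trans ?_ (add_le_add h1 h2)
  rw [Finset.sum_filter, Finset.sum_filter, ← Finset.sum_add_distrib]
  refine Finset.sum_le_sum fun y _ => ?_
  have p1 := (jointPmf_pos hμ hπ S.1 y).le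
  have p2 := (jointPmf_pos hμ hπ S'.1 y).le
  by_cases h : δ n y = S
  · have h' : δ n y ≠ S' := h ▸ hS
    rw [if_pos h', if_neg (not_not.2 h), zero_add]
    exact min_le_right _ _
  · rw [if_pos h]
    refine (min_le_left _ _).trans (le_add_of_nonneg_right ?_)
    split_ifs
    exacts [p2, le_rfl]

/-- The bound `u` is chosen before the test: it is `C + √(K / n) + log 2 / n`, where `log 2` pays
for replacing the sum of two errors by twice the maximum. -/
theorem exists_tendsto_errorRate_le (hμ : ∀ i y, 0 < μ i y) (hπ : ∀ y, 0 < π y)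
    (hμ1 : ∀ i, ∑ y, μ i y = 1) (hπ1 : ∑ y, π y = 1) [Nonempty 𝒴] {S S' : Hypothesis M T}
    (hS : S ≠ S') : ∃ u : ℕ → ℝ,
      Tendsto u atTop (𝓝 (chernoff (singlePmf μ π S.1) (singlePmf μ π S'.1))) ∧
      ∀ (δ : Test 𝒴 M T), ∀ n, 0 < n → errorRate μ π δ n ≤ u n := by
  set C := chernoff (singlePmf μ π S.1) (singlePmf μ π S'.1)
  obtain ⟨K, hK, hb⟩ := exists_le_sum_min_prod (singlePmf_pos hμ hπ S.1)
    (singlePmf_pos hμ hπ S'.1) (sum_singlePmf hμ1 hπ1 S.1) (sum_singlePmf hμ1 hπ1 S'.1)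
  refine ⟨fun n => C + √(K / n) + Real.log 2 / n, ?_, fun δ n hn => ?_⟩
  · have h1 : Tendsto (fun n : ℕ => √(K / n)) atTop (𝓝 0) := by
      simpa using (tendsto_const_div_atTop_nhds_zero_nat K).sqrt
    simpa using (tendsto_const_nhds.add h1).add
      (tendsto_const_div_atTop_nhds_zero_nat (Real.log 2))
  · have hn' : (0 : ℝ) < n := Nat.cast_pos.2 hn
    have h := sum_min_le_two_mul_maxError hμ hπ δ n hS
    simp only [jointPmf_eq_prod_singlePmf] at h
    rw [sum_observations n fun y => min (∏ k, singlePmf μ π S.1 (y k))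
      (∏ k, singlePmf μ π S'.1 (y k))] at h
    have h' := (hb n hn).trans h
    have hpos : 0 < maxError μ π δ n := by
      have := (Real.exp_pos _).trans_le h'
      linarith
    rw [← Real.le_log_iff_exp_le (by positivity), Real.log_mul two_ne_zero hpos.ne'] at h'
    have hsq : √(n * K) = n * √(K / n) := by
      rw [show (n : ℝ) * K = n ^ 2 * (K / n) by field_simp, Real.sqrt_mul (sq_nonneg _),
        Real.sqrt_sq hn'.le]
    rw [hsq] at h'
    rw [errorRate, neg_mul, one_div, inv_mul_eq_div, ← neg_div, div_le_iff₀ hn', add_mul,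
      div_mul_cancel₀ _ hn'.ne']
    linarith

theorem exists_maximumLikelihood {𝒴 : Type*} (μ : Fin M → 𝒴 → ℝ) (π : 𝒴 → ℝ)
    [Nonempty (Hypothesis M T)] :
    ∃ δ : Test 𝒴 M T, ∀ n y (S : Hypothesis M T), jointPmf μ π S.1 y ≤ jointPmf μ π (δ n y).1 y := by
  have h : ∀ (n : ℕ) (y : Observations 𝒴 M n), ∃ S₀ : Hypothesis M T, ∀ S : Hypothesis M T,
      jointPmf μ π S.1 y ≤ jointPmf μ π S₀.1 y := fun n y => Finite.exists_max _
  choose δ hδ using h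
  exact ⟨δ, hδ⟩

/-- Where the test decides `S'`, one has `p_S ≤ p_S'`, hence `p_S ≤ p_S^s p_S'^(1-s)`, whose total
sum is the `n`-th power of the affinity. The exponent `s` may vary with the pair, since the union
bound treats the wrong decisions separately. -/
theorem maxError_le_of_maximumLikelihood (hμ : ∀ i y, 0 < μ i y) (hπ : ∀ y, 0 < π y)
    [Nonempty (Hypothesis M T)] {δ : Test 𝒴 M T}
    (hδ : ∀ n y (S : Hypothesis M T), jointPmf μ π S.1 y ≤ jointPmf μ π (δ n y).1 y) {E : ℝ}
    (hE : ∀ S S' : Hypothesis M T, S ≠ S' → ∃ s ∈ Set.Icc (0 : ℝ) 1,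
      affinity (singlePmf μ π S.1) (singlePmf μ π S'.1) s ≤ Real.exp (-E)) (n : ℕ) :
    maxError μ π δ n ≤ Fintype.card (Hypothesis M T) * Real.exp (-E) ^ n := by
  refine ciSup_le fun S => ?_
  have hc : ∀ S' : Hypothesis M T,
      ∑ y : Observations 𝒴 M n with δ n y ≠ S ∧ δ n y = S', jointPmf μ π S.1 y ≤
        Real.exp (-E) ^ n := by
    intro S'
    by_cases hS : S = S'
    · subst hS
      rw [Finset.filter_false_of_mem fun y _ h => h.1 h.2, Finset.sum_empty]
      positivity
    · obtain ⟨s, hs, h⟩ := hE S S' hS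
      refine le_trans ?_ (pow_le_pow_left₀
        (affinity_nonneg (singlePmf_pos hμ hπ S.1) (singlePmf_pos hμ hπ S'.1) s) h n)
      rw [← sum_jointPmf_rpow hμ hπ, Finset.sum_filter]
      refine Finset.sum_le_sum fun y _ => ?_
      have p1 := jointPmf_pos hμ hπ S.1 y
      have p2 := jointPmf_pos hμ hπ S'.1 y
      split_ifs with hy
      · have hle : jointPmf μ π S.1 y ≤ jointPmf μ π S'.1 y := by
          have := hδ n y S
          rwa [hy.2] at this
        calc jointPmf μ π S.1 y = jointPmf μ π S.1 y ^ s * jointPmf μ π S.1 y ^ (1 - s) := by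
              rw [← Real.rpow_add p1, add_sub_cancel, Real.rpow_one]
          _ ≤ _ := mul_le_mul_of_nonneg_left
              (Real.rpow_le_rpow p1.le hle (sub_nonneg.2 hs.2)) (Real.rpow_nonneg p1.le _)
      · exact mul_nonneg (Real.rpow_nonneg p1.le _) (Real.rpow_nonneg p2.le _)
  calc ∑ y : Observations 𝒴 M n with δ n y ≠ S, jointPmf μ π S.1 y
      = ∑ S' : Hypothesis M T, ∑ y : Observations 𝒴 M n with δ n y ≠ S ∧ δ n y = S',
          jointPmf μ π S.1 y := by
        rw [← Finset.sum_fiberwise _ (δ n)]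
        simp only [Finset.filter_filter]
    _ ≤ ∑ _S' : Hypothesis M T, Real.exp (-E) ^ n := Finset.sum_le_sum fun S' _ => hc S'
    _ = _ := by simp

theorem isOptimalErrorExponent_iInf_chernoff (hμ : ∀ i y, 0 < μ i y) (hπ : ∀ y, 0 < π y)
    (hμ1 : ∀ i, ∑ y, μ i y = 1) (hπ1 : ∑ y, π y = 1) (hT : 0 < T) (hTM : T < M) :
    IsOptimalErrorExponent T μ π
      (⨅ ij : {ij : Fin M × Fin M // ij.1 < ij.2},
        chernoff (fun z : 𝒴 × 𝒴 => μ ij.1.1 z.1 * π z.2)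
          (fun z : 𝒴 × 𝒴 => π z.1 * μ ij.1.2 z.2)) := by
  have : Nonempty 𝒴 := by
    by_contra h
    rw [not_nonempty_iff] at h
    simp at hπ1
  have : Nonempty {ij : Fin M × Fin M // ij.1 < ij.2} :=
    ⟨⟨(⟨0, by omega⟩, ⟨1, by omega⟩), by simp⟩⟩
  set f : {ij : Fin M × Fin M // ij.1 < ij.2} → ℝ := fun ij =>
    chernoff (fun z : 𝒴 × 𝒴 => μ ij.1.1 z.1 * π z.2)
      (fun z : 𝒴 × 𝒴 => π z.1 * μ ij.1.2 z.2)
  obtain ⟨⟨⟨i, j⟩, hij⟩, hmin⟩ := exists_eq_ciInf_of_finite (f := f)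
  have hfle : ∀ ij, ⨅ ij, f ij ≤ f ij := fun ij => ciInf_le (Set.finite_range f).bddBelow ij
  -- The `T - 1` outliers common to the two neighbouring hypotheses that realize the minimizing pair
  -- `(i, j)`.
  obtain ⟨R, hR, hRc⟩ : ∃ R ⊆ ({i, j} : Finset (Fin M))ᶜ, R.card = T - 1 :=
    Finset.exists_subset_card_eq (by
      rw [Finset.card_compl, Fintype.card_fin, Finset.card_pair hij.ne]; omega)
  have hi : i ∉ R := fun h => by simpa using hR h
  have hj : j ∉ R := fun h => by simpa using hR h
  let S : Hypothesis M T := ⟨insert i R, by rw [Finset.card_insert_of_notMem hi]; omega⟩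
  let S' : Hypothesis M T := ⟨insert j R, by rw [Finset.card_insert_of_notMem hj]; omega⟩
  have hSS' : S ≠ S' := fun h => by
    have h1 : insert i R = insert j R := congrArg Subtype.val h
    have h2 : i ∈ insert j R := h1 ▸ Finset.mem_insert_self i R
    rcases Finset.mem_insert.1 h2 with h3 | h3
    exacts [hij.ne h3, hi h3]
  have : Nonempty (Hypothesis M T) := ⟨S⟩
  obtain ⟨u, hu, hub⟩ := exists_tendsto_errorRate_le hμ hπ hμ1 hπ1 hSS'
  rw [chernoff_singlePmf_insert hμ hπ hμ1 hπ1 hij.ne hi hj] at hu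
  change Tendsto u atTop (𝓝 (f ⟨(i, j), hij⟩)) at hu
  rw [hmin] at hu
  refine ⟨?_, fun δ => ?_⟩
  · obtain ⟨δ, hδ⟩ := exists_maximumLikelihood (T := T) μ π
    have hE : ∀ S S' : Hypothesis M T, S ≠ S' → ∃ s ∈ Set.Icc (0 : ℝ) 1,
        affinity (singlePmf μ π S.1) (singlePmf μ π S'.1) s ≤ Real.exp (-⨅ ij, f ij) := by
      intro A B hAB
      have hne : A.1 ≠ B.1 := fun h => hAB (Subtype.ext h)
      -- Distinct sets of equal size are not nested, so each has an element outside the other.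
      obtain ⟨a, ha, ha'⟩ : ∃ a ∈ A.1, a ∉ B.1 := Finset.not_subset.1 fun h =>
        hne (Finset.eq_of_subset_of_card_le h (by rw [A.2, B.2]))
      obtain ⟨b, hb, hb'⟩ : ∃ b ∈ B.1, b ∉ A.1 := Finset.not_subset.1 fun h =>
        hne (Finset.eq_of_subset_of_card_le h (by rw [A.2, B.2])).symm
      have hab : a ≠ b := fun h => hb' (h ▸ ha)
      rcases hab.lt_or_gt with h | h
      · obtain ⟨s, hs, hsC⟩ := exists_chernoff_eq
          (p := fun z : 𝒴 × 𝒴 => μ a z.1 * π z.2) (q := fun z : 𝒴 × 𝒴 => π z.1 * μ b z.2)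
          (fun z => mul_pos (hμ _ _) (hπ _)) (fun z => mul_pos (hπ _) (hμ _ _))
        rw [affinity_mul (hμ a) hπ hπ (hμ b)] at hsC
        refine ⟨s, hs, (affinity_singlePmf_le hμ hπ hμ1 hπ1 ha ha' hb' hb hs).trans ?_⟩
        rw [← hsC]
        exact Real.exp_le_exp.2 (neg_le_neg (hfle ⟨(a, b), h⟩))
      -- The infimum contains only the ordered pair `(b, a)`. Exchanging the two arguments turns its
      -- optimal `s` into `1 - s`.
      · obtain ⟨s, hs, hsC⟩ := exists_chernoff_eq
          (p := fun z : 𝒴 × 𝒴 => μ b z.1 * π z.2) (q := fun z : 𝒴 × 𝒴 => π z.1 * μ a z.2)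
          (fun z => mul_pos (hμ _ _) (hπ _)) (fun z => mul_pos (hπ _) (hμ _ _))
        rw [affinity_mul (hμ b) hπ hπ (hμ a), affinity_swap (μ b), affinity_swap π (μ a)] at hsC
        have hs' : 1 - s ∈ Set.Icc (0 : ℝ) 1 := ⟨sub_nonneg.2 hs.2, sub_le_self _ hs.1⟩
        refine ⟨1 - s, hs', (affinity_singlePmf_le hμ hπ hμ1 hπ1 ha ha' hb' hb hs').trans ?_⟩
        rw [mul_comm, ← hsC]
        exact Real.exp_le_exp.2 (neg_le_neg (hfle ⟨(b, a), h⟩))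
    have hup := maxError_le_of_maximumLikelihood hμ hπ hδ hE
    refine ⟨δ, ?_⟩
    have hlow : Tendsto (fun n : ℕ => (⨅ ij, f ij) -
        Real.log (Fintype.card (Hypothesis M T)) / n) atTop (𝓝 (⨅ ij, f ij)) := by
      simpa using tendsto_const_nhds.sub
        (tendsto_const_div_atTop_nhds_zero_nat (Real.log (Fintype.card (Hypothesis M T))))
    refine tendsto_of_tendsto_of_tendsto_of_le_of_le' hlow hu ?_ ?_
    · filter_upwards [eventually_gt_atTop 0] with n hn
      have hn' : (0 : ℝ) < n := Nat.cast_pos.2 hn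
      have hpos : 0 < maxError μ π δ n := by
        have h1 := sum_min_le_two_mul_maxError hμ hπ δ n hSS'
        have h2 : 0 < ∑ y : Observations 𝒴 M n, min (jointPmf μ π S.1 y) (jointPmf μ π S'.1 y) :=
          Finset.sum_pos (fun y _ => lt_min (jointPmf_pos hμ hπ _ y) (jointPmf_pos hμ hπ _ y))
            Finset.univ_nonempty
        linarith
      have hc : (0 : ℝ) < Fintype.card (Hypothesis M T) := Nat.cast_pos.2 Fintype.card_pos
      have hl := Real.log_le_log hpos (hup n)
      rw [Real.log_mul hc.ne' (pow_pos (Real.exp_pos _) n).ne', Real.log_pow, Real.log_exp] at hl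
      rw [errorRate, neg_mul, one_div, inv_mul_eq_div, ← neg_div, le_div_iff₀ hn', sub_mul,
        div_mul_cancel₀ _ hn'.ne']
      linarith
    · filter_upwards [eventually_gt_atTop 0] with n hn
      exact hub δ n hn
  · have hu' : Tendsto (fun n => (u n : EReal)) atTop (𝓝 ((⨅ ij, f ij : ℝ) : EReal)) :=
      (continuous_coe_real_ereal.tendsto _).comp hu
    rw [← hu'.limsup_eq]
    refine limsup_le_limsup ?_
    filter_upwards [eventually_gt_atTop 0] with n hn
    exact EReal.coe_le_coe_iff.2 (hub δ n hn)

end Testing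

/-! ### Identically distributed outliers -/

/-- Cauchy–Schwarz: the product of the summands `p^s q^(1-s)` and `q^s p^(1-s)` is `p q` for every
`s`. -/
theorem affinity_half_sq_le {α : Type*} [Fintype α] {p q : α → ℝ} (hp : ∀ y, 0 < p y)
    (hq : ∀ y, 0 < q y) (s : ℝ) :
    affinity p q (1 / 2) ^ 2 ≤ affinity p q s * affinity q p s := by
  refine Finset.sum_sq_le_sum_mul_sum_of_sq_le_mul _
    (fun y _ => mul_nonneg (Real.rpow_nonneg (hp y).le _) (Real.rpow_nonneg (hq y).le _))
    (fun y _ => mul_nonneg (Real.rpow_nonneg (hq y).le _) (Real.rpow_nonneg (hp y).le _))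
    fun y _ => le_of_eq ?_
  calc (p y ^ (1 / 2 : ℝ) * q y ^ (1 - 1 / 2 : ℝ)) ^ 2
      = (p y ^ (1 / 2 : ℝ) * p y ^ (1 / 2 : ℝ)) * (q y ^ (1 / 2 : ℝ) * q y ^ (1 / 2 : ℝ)) := by
        norm_num
        ring
    _ = (p y ^ s * p y ^ (1 - s)) * (q y ^ s * q y ^ (1 - s)) := by
        rw [← Real.rpow_add (hp y), ← Real.rpow_add (hq y), ← Real.rpow_add (hp y),
          ← Real.rpow_add (hq y)]
        norm_num
    _ = _ := by ring

/-- The affinity of the swapped products is `affinity p q s * affinity q p s`, which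
`affinity_half_sq_le` bounds below by its value at `s = 1/2`. -/
theorem chernoff_mul_swap {α : Type*} [Fintype α] [Nonempty α] {p q : α → ℝ}
    (hp : ∀ y, 0 < p y) (hq : ∀ y, 0 < q y) :
    chernoff (fun z : α × α => p z.1 * q z.2) (fun z : α × α => q z.1 * p z.2) =
      2 * bhattacharyya p q := by
  have hB : Real.exp (-(2 * bhattacharyya p q)) = affinity p q (1 / 2) ^ 2 := by
    have h : bhattacharyya p q = -Real.log (affinity p q (1 / 2)) := by
      simp only [bhattacharyya, affinity]
      norm_num
    rw [h, show -(2 * -Real.log (affinity p q (1 / 2))) =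
      (2 : ℕ) * Real.log (affinity p q (1 / 2)) by push_cast; ring, Real.exp_nat_mul,
      Real.exp_log (affinity_pos hp hq _)]
  have hpq : ∀ z : α × α, 0 < p z.1 * q z.2 := fun z => mul_pos (hp _) (hq _)
  have hqp : ∀ z : α × α, 0 < q z.1 * p z.2 := fun z => mul_pos (hq _) (hp _)
  rw [← neg_inj, ← Real.exp_injective.eq_iff, hB]
  refine le_antisymm ?_ ?_
  · have h := exp_neg_chernoff_le hpq hqp (s := 1 / 2) (by constructor <;> norm_num)
    rw [affinity_mul hp hq hq hp, affinity_swap q p] at h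
    norm_num at h ⊢
    rwa [sq]
  · obtain ⟨s, -, h⟩ := exists_chernoff_eq hpq hqp
    rw [h, affinity_mul hp hq hq hp]
    exact affinity_half_sq_le hp hq s

end OutlierTesting

theorem proposition7 {𝒴 : Type*} [Fintype 𝒴] :
    (∀ (M T : ℕ), 1 < T → 2 * T < M →
      ∀ (μ : Fin M → 𝒴 → ℝ) (π : 𝒴 → ℝ),
        (∀ i, μ i ∈ stdSimplex ℝ 𝒴) → π ∈ stdSimplex ℝ 𝒴 →
        (∀ i y, 0 < μ i y) → (∀ y, 0 < π y) → (∀ i, μ i ≠ π) →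
        OutlierTesting.IsOptimalErrorExponent T μ π
          (⨅ ij : {ij : Fin M × Fin M // ij.1 < ij.2},
            OutlierTesting.chernoff
              (fun z : 𝒴 × 𝒴 => μ ij.1.1 z.1 * π z.2)
              (fun z : 𝒴 × 𝒴 => π z.1 * μ ij.1.2 z.2))) ∧
    (∀ (μ π : 𝒴 → ℝ),
        μ ∈ stdSimplex ℝ 𝒴 → π ∈ stdSimplex ℝ 𝒴 →
        (∀ y, 0 < μ y) → (∀ y, 0 < π y) → μ ≠ π →
        ∀ (M T : ℕ), 1 < T → 2 * T < M →
          OutlierTesting.IsOptimalErrorExponent T (fun _ : Fin M => μ) π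
            (2 * OutlierTesting.bhattacharyya μ π)) := by
  refine ⟨fun M T hT hTM μ π hμs hπs hμ hπ _ => ?_, fun μ π hμs hπs hμ hπ hne M T hT hTM => ?_⟩
  · exact OutlierTesting.isOptimalErrorExponent_iInf_chernoff hμ hπ (fun i => (hμs i).2) hπs.2
      (by omega) (by omega)
  · have : Nonempty 𝒴 := by
      by_contra h
      rw [not_nonempty_iff] at h
      exact hne (Subsingleton.elim _ _)
    -- All terms of the infimum coincide, but it equals their common value only over a nonempty
    -- index type.
    have : Nonempty {ij : Fin M × Fin M // ij.1 < ij.2} :=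
      ⟨⟨(⟨0, by omega⟩, ⟨1, by omega⟩), by simp⟩⟩
    have h := OutlierTesting.isOptimalErrorExponent_iInf_chernoff (M := M) (T := T)
      (μ := fun _ => μ) (fun _ => hμ) hπ (fun _ => hμs.2) hπs.2 (by omega) (by omega)
    rwa [ciInf_const, OutlierTesting.chernoff_mul_swap hμ hπ] at h
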